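/- Let $X$ be a compact path-connected topological space, let $a \in H^1(X;\mathbb{R})$ be a class in singular cohomology, and let $\mathrm{Homeo}(X,a)$ be the group of homeomorphisms $h$ of $X$ with $h^*a=a$. Let $\alpha$ be a singular one-cocycle representing $a$. For $h\in\mathrm{Homeo}(X,a)$ let $K_\alpha(h)$ be the real-valued function on $X$, unique up to an additive constant, with $\delta K_\alpha(h)=h^*\alpha-\alpha$, and assume that $\alpha$ is a continuous representative, i.e. that $K_\alpha(h)$ is continuous for every $h\in\mathrm{Homeo}(X,a)$. For $z\in X$ and $h,k\in\mathrm{Homeo}(X,a)$ put $G_{z}(h,k)=\int_\gamma (h^*\alpha-\alpha)$, where $\gamma$ is any path from $z$ to $k(z)$. Let $g\in\mathrm{Homeo}(X,a)$ and suppose that for some points $x,y\in X$ the functions $G_x$ and $G_y$ are bounded on $\langle g\rangle\times\langle g\rangle$, where $\langle g\rangle$ is the cyclic subgroup generated by $g$. If the function (a quasimorphism, by the boundedness of $G_x$ and $G_y$) $q(g^n)=K_\alpha(g^n)(y)-K_\alpha(g^n)(x)$ on $\langle g\rangle$ is unbounded, then $g$ is undistorted in $\mathrm{Homeo}(X,a)$: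 for every finitely generated subgroup $\Gamma\subseteq\mathrm{Homeo}(X,a)$ containing $g$ and every finite generating set $S$ of $\Gamma$, the translation length $\lim_{n\to\infty}|g^n|_S/n$ exists and is positive, where $|\cdot|_S$ denotes the word norm. -/

import Mathlib

open Filter Topology

noncomputable section

namespace Distortion

/-! ### Singular cochains with real coefficients and first cohomology -/

/-- Singular `n`-simplices of `X`. -/
abbrev Simplex (X : Type*) [TopologicalSpace X] (n : ℕ) : Type _ :=
  C(stdSimplex ℝ (Fin (n + 1)), X)

/-- The `i`-th face of a singular simplex. -/
def face {X : Type*} [TopologicalSpace X] {n : ℕ} (i : Fin (n + 2)) (σ : Simplex X (n + 1)) :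
    Simplex X n :=
  σ.comp ⟨stdSimplex.map i.succAbove, stdSimplex.continuous_map _⟩

/-- Real singular `n`-cochains: a homomorphism from the group of `n`-chains to `ℝ` is given by its
values on singular simplices. -/
abbrev Cochain (X : Type*) [TopologicalSpace X] (n : ℕ) : Type _ := Simplex X n → ℝ

/-- The singular coboundary `(δ c)(σ) = ∑ i, (-1) ^ i * c (σ ∘ dᵢ)`. -/
def coboundary (X : Type*) [TopologicalSpace X] (n : ℕ) : Cochain X n →ₗ[ℝ] Cochain X (n + 1) where
  toFun c σ := ∑ i : Fin (n + 2), (-1 : ℝ) ^ (i : ℕ) * c (face i σ)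
  map_add' c d := by
    funext σ
    simp [mul_add, Finset.sum_add_distrib]
  map_smul' r c := by
    funext σ
    simp only [Pi.smul_apply, smul_eq_mul, RingHom.id_apply, Finset.mul_sum]
    exact Finset.sum_congr rfl fun i _ => by ring

/-- Pull-back of cochains along a continuous map. -/
def pullback {X Y : Type*} [TopologicalSpace X] [TopologicalSpace Y] (f : C(X, Y)) (n : ℕ) :
    Cochain Y n →ₗ[ℝ] Cochain X n where
  toFun c σ := c (f.comp σ)
  map_add' _ _ := rfl
  map_smul' _ _ := rfl

theorem coboundary_pullback {X Y : Type*} [TopologicalSpace X] [TopologicalSpace Y] (f : C(X, Y))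
    (n : ℕ) (c : Cochain Y n) :
    coboundary X n (pullback f n c) = pullback f (n + 1) (coboundary Y n c) := rfl

/-- Singular one-cocycles `Z¹(X; ℝ)`. -/
abbrev Z1 (X : Type*) [TopologicalSpace X] : Submodule ℝ (Cochain X 1) :=
  LinearMap.ker (coboundary X 1)

/-- Singular one-coboundaries `B¹(X; ℝ)`, as a submodule of `Z¹(X; ℝ)`. -/
abbrev B1 (X : Type*) [TopologicalSpace X] : Submodule ℝ (Z1 X) :=
  (LinearMap.range (coboundary X 0)).submoduleOf (Z1 X)

/-- The first singular cohomology `H¹(X; ℝ) = Z¹(X; ℝ) / B¹(X; ℝ)`. -/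
abbrev H1 (X : Type*) [TopologicalSpace X] : Type _ := Z1 X ⧸ B1 X

/-- The cohomology class of a one-cocycle. -/
def cls {X : Type*} [TopologicalSpace X] (α : Z1 X) : H1 X := Submodule.Quotient.mk α

/-- Pull-back of one-cocycles. -/
def pullbackZ1 {X Y : Type*} [TopologicalSpace X] [TopologicalSpace Y] (f : C(X, Y)) :
    Z1 Y →ₗ[ℝ] Z1 X :=
  (pullback f 1).restrict fun c hc => by
    rw [LinearMap.mem_ker] at hc ⊢
    rw [coboundary_pullback, hc, map_zero]

/-- The map `f^* : H¹(Y; ℝ) → H¹(X; ℝ)` induced by a continuous map `f : X → Y`. -/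
def pullbackH1 {X Y : Type*} [TopologicalSpace X] [TopologicalSpace Y] (f : C(X, Y)) :
    H1 Y →ₗ[ℝ] H1 X :=
  Submodule.mapQ (B1 Y) (B1 X) (pullbackZ1 f) (by
    rintro ⟨c, hc⟩ ⟨d, hd⟩
    refine ⟨pullback f 0 d, ?_⟩
    rw [coboundary_pullback, hd]
    rfl)

theorem pullbackH1_id {X : Type*} [TopologicalSpace X] (a : H1 X) :
    pullbackH1 (ContinuousMap.id X) a = a := by
  obtain ⟨c, rfl⟩ := Submodule.Quotient.mk_surjective _ a
  rfl

theorem pullbackH1_comp {X Y Z : Type*} [TopologicalSpace X] [TopologicalSpace Y]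
    [TopologicalSpace Z] (g : C(Y, Z)) (f : C(X, Y)) (a : H1 Z) :
    pullbackH1 (g.comp f) a = pullbackH1 f (pullbackH1 g a) := by
  obtain ⟨c, rfl⟩ := Submodule.Quotient.mk_surjective _ a
  rfl

/-! ### The group of homeomorphisms preserving a class -/

/-- A homeomorphism as a continuous map. -/
abbrev toC {X : Type*} [TopologicalSpace X] (g : X ≃ₜ X) : C(X, X) := ⟨g, g.continuous⟩

/-- `Homeo(X, a)`: the group (under composition) of homeomorphisms `g` of `X` with `g^* a = a`. -/
def HomeoPreserving {X : Type*} [TopologicalSpace X] (a : H1 X) : Subgroup (X ≃ₜ X) where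
  carrier := {g | pullbackH1 (toC g) a = a}
  one_mem' := pullbackH1_id a
  mul_mem' {g h} hg hh := by
    have hg' : pullbackH1 (toC g) a = a := hg
    have hh' : pullbackH1 (toC h) a = a := hh
    have hgh : toC (g * h) = (toC g).comp (toC h) := rfl
    change pullbackH1 (toC (g * h)) a = a
    rw [hgh, pullbackH1_comp, hg', hh']
  inv_mem' {g} hg := by
    have hg' : pullbackH1 (toC g) a = a := hg
    have hgg : (toC g).comp (toC g⁻¹) = ContinuousMap.id X := by
      ext x
      simp
    change pullbackH1 (toC g⁻¹) a = a
    conv_lhs => rw [← hg']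
    rw [← pullbackH1_comp, hgg, pullbackH1_id]

/-! ### The one-cocycle `K` with values in functions modulo constants -/

/-- A function on `X` as a singular `0`-cochain. -/
def ofFun {X : Type*} [TopologicalSpace X] (f : X → ℝ) : Cochain X 0 :=
  fun σ => f (σ (stdSimplex.vertex 0))

/-- The constant functions on `X`. -/
abbrev constFun (X : Type*) : Submodule ℝ (X → ℝ) := Submodule.span ℝ {1}

/-- Functions on `X` modulo constants, `C⁰(X; ℝ) / ℝ`. -/
abbrev FunModConst (X : Type*) : Type _ := (X → ℝ) ⧸ constFun X

/-- `diffAt x y [f] = f y - f x`. -/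
def diffAt {X : Type*} (x y : X) : FunModConst X →ₗ[ℝ] ℝ :=
  (constFun X).liftQ
    { toFun := fun f => f y - f x
      map_add' := fun f f' => by simp only [Pi.add_apply]; ring
      map_smul' := fun r f => by
        simp only [Pi.smul_apply, smul_eq_mul, RingHom.id_apply]; ring } (by
    rw [Submodule.span_le]
    rintro f rfl
    exact sub_self (1 : ℝ))

theorem diffAt_mk {X : Type*} (x y : X) (f : X → ℝ) :
    diffAt x y (Submodule.Quotient.mk f) = f y - f x := rfl

/-- A class of functions modulo constants is continuous if its representatives are. -/
def FunModConst.IsContinuous {X : Type*} [TopologicalSpace X] (k : FunModConst X) : Prop :=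
  ∃ f : X → ℝ, Continuous f ∧ Submodule.Quotient.mk f = k

theorem coboundary_ofFun {X : Type*} [TopologicalSpace X] (f : X → ℝ) (σ : Simplex X 1) :
    coboundary X 0 (ofFun f) σ =
      f (σ (stdSimplex.vertex 1)) - f (σ (stdSimplex.vertex 0)) := by
  have h0 : stdSimplex.map (S := ℝ) (Fin.succAbove (0 : Fin 2)) (stdSimplex.vertex 0) =
      stdSimplex.vertex 1 := by
    rw [stdSimplex.map_vertex]; rfl
  have h1 : stdSimplex.map (S := ℝ) (Fin.succAbove (1 : Fin 2)) (stdSimplex.vertex 0) =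
      stdSimplex.vertex 0 := by
    rw [stdSimplex.map_vertex]; rfl
  change ∑ i : Fin 2, (-1 : ℝ) ^ (i : ℕ) *
    f (σ (stdSimplex.map (S := ℝ) i.succAbove (stdSimplex.vertex 0))) = _
  rw [Fin.sum_univ_two, h0, h1]
  simp
  ring

/-- For `g` preserving the class of `α` the cocycle `g^* α - α` is exact. -/
theorem exists_primitive {X : Type*} [TopologicalSpace X] {a : H1 X} {α : Z1 X}
    (hα : cls α = a) (g : HomeoPreserving a) :
    ∃ f : X → ℝ, coboundary X 0 (ofFun f) = pullback (toC g.1) 1 α.1 - α.1 := by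
  have h : pullbackH1 (toC g.1) a = a := g.2
  subst hα
  have h' : cls (pullbackZ1 (toC g.1) α) = cls α := h
  obtain ⟨c, hc⟩ := (Submodule.Quotient.eq _).1 h'
  refine ⟨fun x => c (ContinuousMap.const _ x), ?_⟩
  have : ofFun (fun x => c (ContinuousMap.const _ x)) = c := by
    funext σ
    refine congrArg c (ContinuousMap.ext fun t => ?_)
    exact congrArg σ (Subsingleton.elim _ _)
  rw [this, hc]
  rfl

/-- `K_α(g)`: the function on `X`, modulo constants, with `δ (K_α(g)) = g^* α - α`. -/
def K {X : Type*} [TopologicalSpace X] {a : H1 X} {α : Z1 X} (hα : cls α = a)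
    (g : HomeoPreserving a) : FunModConst X :=
  Submodule.Quotient.mk (Classical.choose (exists_primitive hα g))

/-- A path as a singular one-simplex. -/
def pathSimplex {X : Type*} [TopologicalSpace X] {x y : X} (γ : Path x y) : Simplex X 1 :=
  γ.toContinuousMap.comp (stdSimplexHomeomorphUnitInterval : C(stdSimplex ℝ (Fin 2), unitInterval))

theorem pathSimplex_zero {X : Type*} [TopologicalSpace X] {x y : X} (γ : Path x y) :
    pathSimplex γ (stdSimplex.vertex 0) = x := γ.source

theorem pathSimplex_one {X : Type*} [TopologicalSpace X] {x y : X} (γ : Path x y) :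
    pathSimplex γ (stdSimplex.vertex 1) = y := γ.target

/-- `K_α(g)` is the only class of functions modulo constants with `δ (K_α(g)) = g^* α - α`. -/
theorem mk_eq_K_iff {X : Type*} [TopologicalSpace X] [PathConnectedSpace X] {a : H1 X} {α : Z1 X}
    (hα : cls α = a) (g : HomeoPreserving a) (f : X → ℝ) :
    Submodule.Quotient.mk f = K hα g ↔
      coboundary X 0 (ofFun f) = pullback (toC g.1) 1 α.1 - α.1 := by
  have hk := Classical.choose_spec (exists_primitive hα g)
  unfold K
  set k := Classical.choose (exists_primitive hα g)
  rw [Submodule.Quotient.eq, Submodule.mem_span_singleton]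
  constructor
  · rintro ⟨r, hr⟩
    rw [← hk]
    funext σ
    have h0 := congrFun hr (σ (stdSimplex.vertex 0))
    have h1 := congrFun hr (σ (stdSimplex.vertex 1))
    simp only [Pi.smul_apply, Pi.one_apply, smul_eq_mul, Pi.sub_apply] at h0 h1
    rw [coboundary_ofFun, coboundary_ofFun]
    linarith
  · intro hf
    obtain ⟨x⟩ := (inferInstance : Nonempty X)
    refine ⟨f x - k x, ?_⟩
    funext y
    have h := congrFun (hf.trans hk.symm) (pathSimplex (PathConnectedSpace.somePath x y))
    rw [coboundary_ofFun, coboundary_ofFun, pathSimplex_zero, pathSimplex_one] at h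
    simp only [Pi.smul_apply, Pi.one_apply, smul_eq_mul, Pi.sub_apply]
    linarith

/-- `α` is a continuous representative of `a`: the function `K_α(h)` is continuous for every
`h ∈ Homeo(X, a)`. -/
def IsContinuousRep {X : Type*} [TopologicalSpace X] {a : H1 X} {α : Z1 X} (hα : cls α = a) :
    Prop :=
  ∀ h : HomeoPreserving a, (K hα h).IsContinuous

/-! ### The two-cocycle `G` -/

/-- `G_{x,α}(g, h) = ∫_γ (g^* α - α)` for a path `γ` from `x` to `h x`. -/
def G {X : Type*} [TopologicalSpace X] [PathConnectedSpace X] {a : H1 X} (α : Z1 X) (x : X)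
    (g h : HomeoPreserving a) : ℝ :=
  (pullback (toC g.1) 1 α.1 - α.1) (pathSimplex (PathConnectedSpace.somePath x (h.1 x)))

/-- The value of `G` does not depend on the path. -/
theorem G_eq {X : Type*} [TopologicalSpace X] [PathConnectedSpace X] {a : H1 X} {α : Z1 X}
    (hα : cls α = a) (x : X) (g h : HomeoPreserving a) (γ : Path x (h.1 x)) :
    G α x g h = (pullback (toC g.1) 1 α.1 - α.1) (pathSimplex γ) := by
  obtain ⟨f, hf⟩ := exists_primitive hα g
  simp only [G, ← hf, coboundary_ofFun, pathSimplex_zero, pathSimplex_one]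

/-- The cocycle `G_{x,α}` is bounded on a subgroup `Γ` of `Homeo(X, a)`. -/
def GBoundedOn {X : Type*} [TopologicalSpace X] [PathConnectedSpace X] {a : H1 X} (α : Z1 X)
    (x : X) (Γ : Subgroup (HomeoPreserving a)) : Prop :=
  ∃ C : ℝ, ∀ g ∈ Γ, ∀ h ∈ Γ, |G α x g h| ≤ C

/-- The function `q(h) = K_α(h)(y) - K_α(h)(x)`. -/
def q {X : Type*} [TopologicalSpace X] {a : H1 X} {α : Z1 X} (hα : cls α = a) (x y : X)
    (h : HomeoPreserving a) : ℝ :=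
  diffAt x y (K hα h)

/-! ### Distortion in groups -/

/-- The word norm of `g` with respect to a generating set `S`: the least length of a word in
elements of `S` and their inverses that represents `g`. -/
def wordNorm {Γ : Type*} [Group Γ] (S : Set Γ) (g : Γ) : ℕ :=
  sInf {k | ∃ l : List Γ, l.length = k ∧ (∀ s ∈ l, s ∈ S ∨ s⁻¹ ∈ S) ∧ l.prod = g}

/-- `t` is the translation length of `g` with respect to `S`. -/
def IsTranslationLength {Γ : Type*} [Group Γ] (S : Set Γ) (g : Γ) (t : ℝ) : Prop :=
  Tendsto (fun n : ℕ => (wordNorm S (g ^ n) : ℝ) / n) atTop (𝓝 t)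

/-- An element `g` of a finitely generated group is undistorted if its translation length is
positive, for every finite generating set. -/
def UndistortedFG {Γ : Type*} [Group Γ] (g : Γ) : Prop :=
  ∀ S : Finset Γ, Subgroup.closure (S : Set Γ) = ⊤ →
    ∃ t : ℝ, 0 < t ∧ IsTranslationLength (S : Set Γ) g t

/-- An element `g` of a group is undistorted if it is undistorted in every finitely generated
subgroup that contains it. -/
def Undistorted {Γ : Type*} [Group Γ] (g : Γ) : Prop :=
  ∀ (Λ : Subgroup Γ) (hg : g ∈ Λ), Λ.FG → UndistortedFG (⟨g, hg⟩ : Λ)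

end Distortion

end

open Filter Topology

namespace Distortion

/-! ### Differences of `K` between two points -/

section Difference

variable {X : Type*} [TopologicalSpace X] [PathConnectedSpace X] {a : H1 X} {α : Z1 X}

/-! Differences of `K` bound word length from below. Since `K` is a crossed homomorphism (`q_mul`),
the value of `q` on a word is a sum of its values on the letters, taken at moving pairs of points.
Each letter has a continuous primitive on a compact space, so these values are bounded uniformly in
the points, and `|q| ≤ C * wordNorm` (`exists_abs_q_le_wordNorm`).

On the powers of `g`, the failure of `q` to be additive is a difference of two values of `G`
(`q_mul_eq_add_G`), hence at most some `D`. Unboundedness gives `N` with `|q (g ^ N)| > D`, so `|q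
(g ^ (k * N))|` grows at least linearly in `k` (`abs_quasimorphism_pow_ge`), and so does the word
norm. The translation length exists by Fekete's lemma. -/

theorem q_eq_sub (hα : cls α = a) (x y : X) (h : HomeoPreserving a) {f : X → ℝ}
    (hf : coboundary X 0 (ofFun f) = pullback (toC h.1) 1 α.1 - α.1) :
    q hα x y h = f y - f x := by
  rw [q, ← (mk_eq_K_iff hα h f).2 hf, diffAt_mk]

theorem q_add (hα : cls α = a) (x y z : X) (h : HomeoPreserving a) :
    q hα x y h + q hα y z h = q hα x z h := by
  obtain ⟨f, hf⟩ := exists_primitive hα h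
  rw [q_eq_sub hα _ _ h hf, q_eq_sub hα _ _ h hf, q_eq_sub hα _ _ h hf]
  ring

/-- This is `(hk)^*α - α = k^*(h^*α - α) + (k^*α - α)`, read on primitives. -/
theorem q_mul (hα : cls α = a) (x y : X) (h k : HomeoPreserving a) :
    q hα x y (h * k) = q hα (k.1 x) (k.1 y) h + q hα x y k := by
  obtain ⟨f, hf⟩ := exists_primitive hα h
  obtain ⟨f', hf'⟩ := exists_primitive hα k
  have hmul : coboundary X 0 (ofFun (fun z => f (k.1 z) + f' z)) =
      pullback (toC (h * k).1) 1 α.1 - α.1 := by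
    funext σ
    have e := congrFun hf ((toC k.1).comp σ)
    have e' := congrFun hf' σ
    rw [coboundary_ofFun] at e e' ⊢
    change f (k.1 _) - f (k.1 _) =
      α.1 ((toC h.1).comp ((toC k.1).comp σ)) - α.1 ((toC k.1).comp σ) at e
    change _ = α.1 ((toC k.1).comp σ) - α.1 σ at e'
    change _ = α.1 ((toC h.1).comp ((toC k.1).comp σ)) - α.1 σ
    linarith
  rw [q_eq_sub hα _ _ _ hmul, q_eq_sub hα _ _ _ hf, q_eq_sub hα _ _ _ hf']
  ring

theorem q_one (hα : cls α = a) (x y : X) : q hα x y 1 = 0 := by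
  have h := q_mul hα x y 1 1
  rw [one_mul] at h
  change _ = q hα x y 1 + _ at h
  linarith

theorem q_inv (hα : cls α = a) (x y : X) (h : HomeoPreserving a) :
    q hα x y h⁻¹ = -q hα ((h⁻¹).1 x) ((h⁻¹).1 y) h := by
  have e := q_mul hα x y h h⁻¹
  rw [mul_inv_cancel, q_one] at e
  linarith

theorem G_eq_q (hα : cls α = a) (x : X) (h k : HomeoPreserving a) :
    G α x h k = q hα x (k.1 x) h := by
  obtain ⟨f, hf⟩ := exists_primitive hα h
  rw [q_eq_sub hα _ _ h hf, G, ← hf, coboundary_ofFun, pathSimplex_zero, pathSimplex_one]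

/-- Replacing the pair `k x, k y` in `q_mul` by `x, y` costs the integrals of `h^*α - α` from `x` to
`k x` and from `y` to `k y`. -/
theorem q_mul_eq_add_G (hα : cls α = a) (x y : X) (h k : HomeoPreserving a) :
    q hα x y (h * k) = q hα x y h + q hα x y k + (G α y h k - G α x h k) := by
  rw [q_mul, G_eq_q hα, G_eq_q hα]
  have h1 := q_add hα x (k.1 x) (k.1 y) h
  have h2 := q_add hα x y (k.1 y) h
  linarith

/-- Compactness and continuity enter here. Uniformity in both points matters because `q_mul` moves
them. -/
theorem exists_abs_q_le {X : Type*} [TopologicalSpace X] [CompactSpace X] {a : H1 X} {α : Z1 X}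
    (hα : cls α = a) (hcont : IsContinuousRep hα)
    (h : HomeoPreserving a) : ∃ C : ℝ, ∀ x y : X, |q hα x y h| ≤ C := by
  obtain ⟨f, hfc, hf⟩ := hcont h
  obtain ⟨C, hC⟩ := isCompact_univ.exists_bound_of_continuousOn hfc.continuousOn
  refine ⟨C + C, fun x y => ?_⟩
  rw [q, ← hf, diffAt_mk]
  exact (abs_sub _ _).trans (add_le_add (hC y trivial) (hC x trivial))

theorem abs_q_prod_le (hα : cls α = a) {C : ℝ} (l : List (HomeoPreserving a))
    (hl : ∀ s ∈ l, ∀ x y : X, |q hα x y s| ≤ C) (x y : X) :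
    |q hα x y l.prod| ≤ C * l.length := by
  induction l generalizing x y with
  | nil => simp [q_one]
  | cons s l ih =>
    rw [List.prod_cons, q_mul, List.length_cons, Nat.cast_add, Nat.cast_one]
    have h1 := hl s (by simp) (l.prod.1 x) (l.prod.1 y)
    have h2 := ih (fun t ht => hl t (by simp [ht])) x y
    have h3 := abs_add_le (q hα (l.prod.1 x) (l.prod.1 y) s) (q hα x y l.prod)
    linarith

end Difference

/-! ### Word norms and translation lengths -/

section WordNorm

variable {Γ : Type*} [Group Γ]

theorem exists_word_of_closure_eq_top {S : Set Γ} (hS : Subgroup.closure S = ⊤) (g : Γ) :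
    ∃ l : List Γ, (∀ s ∈ l, s ∈ S ∨ s⁻¹ ∈ S) ∧ l.prod = g ∧ l.length = wordNorm S g := by
  have hne : {k | ∃ l : List Γ, l.length = k ∧ (∀ s ∈ l, s ∈ S ∨ s⁻¹ ∈ S) ∧
      l.prod = g}.Nonempty := by
    have hg : g ∈ (Subgroup.closure S).toSubmonoid := hS ▸ Subgroup.mem_top g
    rw [Subgroup.closure_toSubmonoid] at hg
    obtain ⟨l, hl, hg⟩ := Submonoid.exists_list_of_mem_closure hg
    exact ⟨_, l, rfl, hl, hg⟩
  obtain ⟨l, h1, h2, h3⟩ := Nat.sInf_mem hne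
  exact ⟨l, h2, h3, h1⟩

theorem wordNorm_mul_le {S : Set Γ} (hS : Subgroup.closure S = ⊤) (g h : Γ) :
    wordNorm S (g * h) ≤ wordNorm S g + wordNorm S h := by
  obtain ⟨l, hl, rfl, hln⟩ := exists_word_of_closure_eq_top hS g
  obtain ⟨m, hm, rfl, hmn⟩ := exists_word_of_closure_eq_top hS h
  rw [← hln, ← hmn]
  refine Nat.sInf_le ⟨l ++ m, List.length_append, fun s hs => ?_, List.prod_append⟩
  exact (List.mem_append.1 hs).elim (hl s) (hm s)

theorem exists_isTranslationLength {S : Set Γ} (hS : Subgroup.closure S = ⊤) (g : Γ) :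
    ∃ t : ℝ, IsTranslationLength S g t := by
  have hsub : Subadditive (fun n : ℕ => (wordNorm S (g ^ n) : ℝ)) := fun m n => by
    dsimp only
    rw [pow_add]
    exact_mod_cast wordNorm_mul_le hS _ _
  refine ⟨hsub.lim, hsub.tendsto_lim ⟨0, ?_⟩⟩
  rintro _ ⟨n, rfl⟩
  positivity

/-- The limit is already determined along the multiples of `N`, so a linear lower bound there
suffices. -/
theorem IsTranslationLength.le {S : Set Γ} {g : Γ} {t c : ℝ} (ht : IsTranslationLength S g t)
    {N : ℕ} (hN : 0 < N) (hc : ∀ k : ℕ, c * (k * N : ℕ) ≤ wordNorm S (g ^ (k * N))) :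
    c ≤ t := by
  have hk : Tendsto (fun k : ℕ => k * N) atTop atTop := tendsto_id.atTop_mul_const' hN
  refine ge_of_tendsto (ht.comp hk) ?_
  filter_upwards [eventually_gt_atTop 0] with k hk0
  rw [Function.comp_apply, le_div_iff₀ (by exact_mod_cast Nat.mul_pos hk0 hN)]
  exact hc k

end WordNorm

/-! ### Linear growth and undistortion -/

theorem exists_abs_q_le_wordNorm {X : Type*} [TopologicalSpace X] [PathConnectedSpace X]
    [CompactSpace X] {a : H1 X} {α : Z1 X} (hα : cls α = a) (hcont : IsContinuousRep hα)
    {Λ : Subgroup (HomeoPreserving a)} (S : Finset Λ)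
    (hS : Subgroup.closure (S : Set Λ) = ⊤) :
    ∃ C : ℝ, 0 < C ∧ ∀ (h : Λ) (x y : X), |q hα x y h.1| ≤ C * wordNorm (S : Set Λ) h := by
  choose B hB using exists_abs_q_le hα hcont
  have hB0 : ∀ h, 0 ≤ B h := fun h => by
    obtain ⟨x⟩ := (inferInstance : Nonempty X)
    exact (abs_nonneg _).trans (hB h x x)
  -- The sum dominates the bound of every generator; the extra `1` makes the constant positive even
  -- for empty `S`.
  have hsum : ∀ s ∈ S, B s.1 ≤ 1 + ∑ s ∈ S, B s.1 := fun s hs => by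
    have := Finset.single_le_sum (f := fun s : Λ => B s.1) (fun t _ => hB0 t.1) hs
    linarith
  refine ⟨1 + ∑ s ∈ S, B s.1, ?_, fun h x y => ?_⟩
  · have := Finset.sum_nonneg (s := S) fun s _ => hB0 s.1
    linarith
  obtain ⟨l, hl, rfl, hlen⟩ := exists_word_of_closure_eq_top hS h
  have hprod := abs_q_prod_le hα (C := 1 + ∑ s ∈ S, B s.1) (l.map Λ.subtype) (fun t ht => ?_) x y
  · rw [← map_list_prod, List.length_map, hlen] at hprod
    exact hprod
  obtain ⟨s, hs, rfl⟩ := List.mem_map.1 ht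
  intro x y
  rcases hl s hs with h | h
  · exact (hB _ x y).trans (hsum s h)
  -- An inverse letter costs no more: `q_inv` only changes the sign and moves the points.
  · have e := q_inv hα x y (s.1)⁻¹
    rw [inv_inv] at e
    change |q hα x y s.1| ≤ _
    rw [e, abs_neg]
    exact (hB _ _ _).trans (hsum _ h)

/-- A quasimorphism on a group grows linearly along the powers of `h` when its value at `h` exceeds
its defect. -/
theorem abs_quasimorphism_pow_ge {Γ : Type*} [Group Γ] {u : Γ → ℝ} {D : ℝ} (hu1 : u 1 = 0) (h : Γ)
    (hu : ∀ k : ℕ, |u (h ^ k * h) - u (h ^ k) - u h| ≤ D) (k : ℕ) :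
    k * (|u h| - D) ≤ |u (h ^ k)| := by
  have key : |u (h ^ k) - k * u h| ≤ k * D := by
    induction k with
    | zero => simp [hu1]
    | succ k ih =>
      rw [pow_succ]
      push_cast
      have := hu k
      rw [abs_le] at this ih ⊢
      constructor <;> linarith
  have h1 := abs_sub_abs_le_abs_sub (k * u h) (u (h ^ k))
  rw [abs_sub_comm, abs_mul, Nat.abs_cast] at h1
  linarith

end Distortion

theorem mainTheorem5 {X : Type*} [TopologicalSpace X] [PathConnectedSpace X] [CompactSpace X]
    (a : Distortion.H1 X) (α : Distortion.Z1 X) (hα : Distortion.cls α = a)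
    (hcont : Distortion.IsContinuousRep hα)
    (g : Distortion.HomeoPreserving a) (x y : X)
    (hx : Distortion.GBoundedOn α x (Subgroup.zpowers g))
    (hy : Distortion.GBoundedOn α y (Subgroup.zpowers g))
    (hq : ¬ ∃ C : ℝ, ∀ h ∈ Subgroup.zpowers g, |Distortion.q hα x y h| ≤ C) :
    Distortion.Undistorted g := by
  intro Λ hg _ S hS
  obtain ⟨t, ht⟩ := Distortion.exists_isTranslationLength hS ⟨g, hg⟩
  refine ⟨t, ?_, ht⟩
  obtain ⟨C, hC0, hC⟩ := Distortion.exists_abs_q_le_wordNorm hα hcont S hS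
  obtain ⟨Cx, hCx⟩ := hx
  obtain ⟨Cy, hCy⟩ := hy
  have hdefect : ∀ h ∈ Subgroup.zpowers g, ∀ k ∈ Subgroup.zpowers g,
      |Distortion.q hα x y (h * k) - Distortion.q hα x y h - Distortion.q hα x y k| ≤
        Cx + Cy := by
    intro h hh k hk
    have h1 := abs_le.1 (hCx h hh k hk)
    have h2 := abs_le.1 (hCy h hh k hk)
    rw [Distortion.q_mul_eq_add_G, abs_le]
    constructor <;> linarith
  have hone := Distortion.q_one hα x y
  obtain ⟨N, hN⟩ : ∃ N : ℕ, Cx + Cy < |Distortion.q hα x y (g ^ N)| := by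
    by_contra! hcon
    -- Nonnegative powers are bounded by the defect; `q (g ^ (-m)) + q (g ^ m)` is within one defect
    -- of `q 1 = 0`, so negative powers are bounded by twice it.
    refine hq ⟨2 * (Cx + Cy), fun h hh => ?_⟩
    obtain ⟨n, rfl⟩ := Subgroup.mem_zpowers_iff.1 hh
    have hn := hcon n.natAbs
    have hD : 0 ≤ Cx + Cy := (abs_nonneg _).trans hn
    obtain ⟨m, rfl | rfl⟩ := n.eq_nat_or_neg
    · rw [Int.natAbs_natCast] at hn
      rw [zpow_natCast]
      linarith
    · rw [Int.natAbs_neg, Int.natAbs_natCast] at hn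
      have hd := hdefect _ hh (g ^ m) (Subgroup.npow_mem_zpowers g m)
      rw [zpow_neg, zpow_natCast] at hd ⊢
      rw [inv_mul_cancel, hone] at hd
      rw [abs_le] at hn hd ⊢
      constructor <;> linarith
  have hD : 0 ≤ Cx + Cy := (abs_nonneg _).trans
    (hdefect 1 (one_mem _) 1 (one_mem _))
  have hN0 : 0 < N := by
    rcases Nat.eq_zero_or_pos N with rfl | h
    · rw [pow_zero, hone, abs_zero] at hN
      linarith
    · exact h
  have hN0' : (0 : ℝ) < N := by exact_mod_cast hN0
  -- Each factor `g ^ N` adds at least `|q (g ^ N)| - D` to the growth bound; dividing by `C`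
  -- converts this to word length, and by `N` to a rate per power of `g`.
  refine lt_of_lt_of_le (b := (|Distortion.q hα x y (g ^ N)| - (Cx + Cy)) / (C * N))
    (div_pos (sub_pos.2 hN) (by positivity)) (ht.le hN0 fun k => ?_)
  have hgrow := Distortion.abs_quasimorphism_pow_ge (u := Distortion.q hα x y) hone (g ^ N)
    (fun k => hdefect _ (pow_mem (Subgroup.npow_mem_zpowers g N) k) _
      (Subgroup.npow_mem_zpowers g N)) k
  rw [← pow_mul, mul_comm N k] at hgrow
  have hword := hC (⟨g, hg⟩ ^ (k * N)) x y
  rw [SubgroupClass.coe_pow] at hword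
  have hle := hgrow.trans hword
  rw [div_mul_eq_mul_div, div_le_iff₀ (by positivity)]
  rw [Nat.cast_mul]
  calc _ = N * (k * (|Distortion.q hα x y (g ^ N)| - (Cx + Cy))) := by ring
    _ ≤ N * (C * Distortion.wordNorm (S : Set Λ) (⟨g, hg⟩ ^ (k * N))) := by gcongr
    _ = _ := by ring
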